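/- Let $\mathcal S\subseteq\mathbb R^d$ be closed, $\mathcal A$ a finite non-empty set, $\gamma\in(0,1)$, and $r:\mathcal S\times\mathcal A\to[0,1]$ continuous in the state. Write $\Delta_{\mathcal S}$ for the Borel probability measures on $\mathcal S$ with the weak topology, and $\Delta_{\mathcal A}$, $\Delta_{[K]}$ for the probability simplices. Let $P_1,\dots,P_K$ be Borel transition kernels from $\mathcal S\times\mathcal A$ to $\mathcal S$ such that $s\mapsto P_k(\cdot|s,a)\in\Delta_{\mathcal S}$ is continuous for all $k$ and $a$, and let $W\subseteq\Delta_{[K]}$ be closed and non-empty. For $s\in\mathcal S$ put $\mathcal P_s=\{\sum_k w_kP_k(\cdot|s,\cdot): w\in W\}$, and let $\mathcal P$ be the set of all Borel transition kernels $P$ with $P(\cdot|s,\cdot)\in\mathcal P_s$ for every $s\in\mathcal S$ (the mixture ambiguity set). Let $\Pi$ be the set of Borel measurable maps $\pi:\mathcal S\to\Delta_{\mathcal A}$, and for $\pi\in\Pi$, $P\in\mathcal P$ let $$V^P_\pi(s)=\mathbb E^P_\pi\Big[\sum_{t\ge0}\gamma^t r(S_t,A_t)\,\Big|\,S_0=s\Big],$$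 where $(S_t,A_t)_{t\ge0}$ is the Markov process with $A_t\sim\pi(\cdot|S_t)$ and $S_{t+1}\sim P(\cdot|S_t,A_t)$. For $v$ in the space $C_b(\mathcal S)$ of bounded continuous functions with the supremum norm, define $$\mathcal T^P_\pi v(s)=\sum_{a}\pi(a|s)\Big[r(s,a)+\gamma\int v\,dP(\cdot|s,a)\Big],\quad \mathcal T_\pi v(s)=\inf_{P\in\mathcal P}\mathcal T^P_\pi v(s),\quad \mathcal Tv(s)=\sup_{\pi\in\Pi}\mathcal T_\pi v(s).$$ Then the following hold. (i) For every $v\in C_b(\mathcal S)$ there is a Borel measurable family $(s,p)\mapsto Q(\cdot|s,p,\cdot)\in\mathcal P_s$, $(s,p)\in\mathcal S\times\Delta_{\mathcal A}$, such that $R=Q(\cdot|s,p,\cdot)$ minimizes $\sum_a p(a)\big[r(s,a)+\gamma\int v\,dR(\cdot|a)\big]$ over $R\in\mathcal P_s$, for every $(s,p)$. For every $\pi\in\Pi$, the kernel $P'(\cdot|s,a)=Q(\cdot|s,\pi(\cdot|s),a)$ lies in $\mathcal P$ and satisfies $\mathcal T^{P'}_\pi v=\mathcal T_\pi v$ on $\mathcal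 S$. Moreover, there is $\pi'\in\Pi$ with $\mathcal T_{\pi'}v=\mathcal Tv$ on $\mathcal S$, and there is a pair $(P',\pi')\in\mathcal P\times\Pi$ with $\mathcal T^{P'}_{\pi'}v=\mathcal T_{\pi'}v=\mathcal Tv$ on $\mathcal S$. (ii) $\mathcal T$ maps $C_b(\mathcal S)$ into itself, and $\|\mathcal Tv-\mathcal Tw\|_\infty\le\gamma\|v-w\|_\infty$ for all $v,w\in C_b(\mathcal S)$. There is a unique $v^\star\in C_b(\mathcal S)$ with $\mathcal Tv^\star=v^\star$, and $\mathcal T^nv_0\to v^\star$ in $C_b(\mathcal S)$ for every $v_0\in C_b(\mathcal S)$. (iii) Every pair $(P^\star,\pi^\star)\in\mathcal P\times\Pi$ with $\mathcal T^{P^\star}_{\pi^\star}v^\star=\mathcal Tv^\star$ on $\mathcal S$ satisfies $$v^\star(s)=V^{P^\star}_{\pi^\star}(s)=\sup_{\pi\in\Pi}\inf_{P\in\mathcal P}V^P_\pi(s)\qquad\text{for all }s\in\mathcal S.$$ Such pairs exist, and one of them can be chosen so that in addition, for every $s\in\mathcal S$, $P^\star$ attains $\inf_{P\in\mathcal P}V^P_{\pi^\star}(s)$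 and $\pi^\star$ attains $\sup_{\pi\in\Pi}\inf_{P\in\mathcal P}V^P_\pi(s)$. -/

import Mathlib

open MeasureTheory ProbabilityTheory Filter Topology
open scoped BoundedContinuousFunction

noncomputable section

namespace RobustMDP

/-- The randomized stationary Borel measurable policies `π : S → Δ_A`, where `Δ_A` is the
probability simplex over the finite set `A`. -/
abbrev Policy (S A : Type) [MeasurableSpace S] [Fintype A] : Type :=
  {π : S → stdSimplex ℝ A // Measurable π}

/-- The transition kernels `P : S × A → Δ_S`. When `A` is finite and discrete, measurability
in `(s, a)` is the same as measurability in `s` for every `a`. -/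
abbrev TransitionKernel (S A : Type) [MeasurableSpace S] [MeasurableSpace A] : Type :=
  {P : Kernel (S × A) S // IsMarkovKernel P}

instance instIsMarkovKernelTransitionKernel {S A : Type} [MeasurableSpace S] [MeasurableSpace A]
    (P : TransitionKernel S A) : IsMarkovKernel P.1 := P.2

section Ambiguity

/-- The next-state law `P(· | s, a)`, as a point of `Δ_S` with the topology of weak convergence. -/
def nextLaw {S A : Type} [MeasurableSpace S] [MeasurableSpace A]
    (P : TransitionKernel S A) (s : S) (a : A) : ProbabilityMeasure S :=
  ⟨P.1 (s, a), inferInstance⟩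

/-- `P(· | s, a)` is continuous in `s` for the weak topology on `Δ_S`, for every action `a`. -/
def WeaklyContinuous {S A : Type} [TopologicalSpace S] [MeasurableSpace S]
    [OpensMeasurableSpace S] [MeasurableSpace A] (P : TransitionKernel S A) : Prop :=
  ∀ a : A, Continuous (fun s : S => nextLaw P s a)

/-- The statewise marginal `P_s = {∑ₖ wₖ Pₖ(· | s, ·) : w ∈ W}`; its elements are families of
measures indexed by the actions, the weights being shared by all actions. -/
def mixtureMarginal {S A : Type} [MeasurableSpace S] [MeasurableSpace A] {K : ℕ}
    (W : Set (Fin K → ℝ)) (Pgen : Fin K → TransitionKernel S A) (s : S) :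
    Set (A → Measure S) :=
  {Q | ∃ w ∈ W, ∀ a, Q a = ∑ k, ENNReal.ofReal (w k) • (Pgen k).1 (s, a)}

/-- The `s`-rectangular set of transition kernels with prescribed statewise marginals. -/
def sRectangular {S A : Type} [MeasurableSpace S] [MeasurableSpace A]
    (M : S → Set (A → Measure S)) : Set (TransitionKernel S A) :=
  {P | ∀ s, (fun a => P.1 (s, a)) ∈ M s}

/-- The mixture ambiguity set generated by the kernels `Pgen k` and the weight set `W`. -/
def mixtureAmbiguitySet {S A : Type} [MeasurableSpace S] [MeasurableSpace A] {K : ℕ}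
    (W : Set (Fin K → ℝ)) (Pgen : Fin K → TransitionKernel S A) :
    Set (TransitionKernel S A) :=
  sRectangular (mixtureMarginal W Pgen)

end Ambiguity

section Bellman

/-- `∑ₐ p(a) [r(s, a) + γ ∫ v(s') Q(ds' | a)]`: the one-step objective at the state `s`, for a
mixed action `p ∈ Δ_A` and next-state laws `Q(· | a)`. -/
def oneStep {S A : Type} [MeasurableSpace S] [Fintype A] (γ : ℝ) (r : S → A → ℝ)
    (v : S → ℝ) (s : S) (p : stdSimplex ℝ A) (Q : A → Measure S) : ℝ :=
  ∑ a, p.1 a * (r s a + γ * ∫ s', v s' ∂(Q a))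

/-- The non-robust Bellman evaluation operator `T_π^P`. -/
def evalOp {S A : Type} [MeasurableSpace S] [Fintype A] [MeasurableSpace A] (γ : ℝ)
    (r : S → A → ℝ) (P : TransitionKernel S A) (π : Policy S A) (v : S → ℝ) (s : S) : ℝ :=
  oneStep γ r v s (π.1 s) (fun a => P.1 (s, a))

/-- The robust Bellman evaluation operator `T_π v(s) = inf_{P ∈ Amb} T_π^P v(s)`. -/
def robustEvalOp {S A : Type} [MeasurableSpace S] [Fintype A] [MeasurableSpace A] (γ : ℝ)
    (r : S → A → ℝ) (Amb : Set (TransitionKernel S A)) (π : Policy S A) (v : S → ℝ) (s : S) : ℝ :=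
  ⨅ P : Amb, evalOp γ r P.1 π v s

/-- The robust Bellman operator `T v(s) = sup_{π ∈ Π} T_π v(s)`. -/
def robustBellman {S A : Type} [MeasurableSpace S] [Fintype A] [MeasurableSpace A] (γ : ℝ)
    (r : S → A → ℝ) (Amb : Set (TransitionKernel S A)) (v : S → ℝ) (s : S) : ℝ :=
  ⨆ π : Policy S A, robustEvalOp γ r Amb π v s

end Bellman

section Value

/-- The probability measure on `A` with mass `p(a)` at `a`. -/
def simplexMeasure {A : Type} [Fintype A] [MeasurableSpace A] (p : stdSimplex ℝ A) : Measure A :=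
  ∑ a, ENNReal.ofReal (p.1 a) • Measure.dirac a

instance instIsProbabilityMeasureSimplexMeasure {A : Type} [Fintype A] [MeasurableSpace A]
    (p : stdSimplex ℝ A) : IsProbabilityMeasure (simplexMeasure p) := by
  constructor
  simp only [simplexMeasure, Measure.finsetSum_apply, Measure.smul_apply, measure_univ,
    smul_eq_mul, mul_one]
  rw [← ENNReal.ofReal_sum_of_nonneg (fun a _ => p.2.1 a), p.2.2, ENNReal.ofReal_one]

/-- A policy seen as a Markov kernel from states to actions. -/
def actionKernel {S A : Type} [MeasurableSpace S] [Fintype A] [MeasurableSpace A]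
    (π : Policy S A) : Kernel S A where
  toFun s := simplexMeasure (π.1 s)
  measurable' := by
    refine Measure.measurable_of_measurable_coe _ (fun B _ => ?_)
    simp only [simplexMeasure, Measure.finsetSum_apply, Measure.smul_apply, smul_eq_mul]
    refine Finset.measurable_sum _ (fun a _ => ?_)
    exact (ENNReal.measurable_ofReal.comp
      ((measurable_pi_apply a).comp (measurable_subtype_coe.comp π.2))).mul_const _

instance instIsMarkovKernelActionKernel {S A : Type} [MeasurableSpace S] [Fintype A]
    [MeasurableSpace A] (π : Policy S A) : IsMarkovKernel (actionKernel π) :=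
  ⟨fun s => instIsProbabilityMeasureSimplexMeasure (π.1 s)⟩

/-- One step of the state-action process: from `(s, a)` draw `s' ∼ P(· | s, a)` and then
`a' ∼ π(· | s')`. -/
def stepKernel {S A : Type} [MeasurableSpace S] [Fintype A] [MeasurableSpace A]
    (P : TransitionKernel S A) (π : Policy S A) : Kernel (S × A) (S × A) :=
  P.1 ⊗ₖ Kernel.prodMkLeft (S × A) (actionKernel π)

instance instIsMarkovKernelStepKernel {S A : Type} [MeasurableSpace S] [Fintype A]
    [MeasurableSpace A] (P : TransitionKernel S A) (π : Policy S A) :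
    IsMarkovKernel (stepKernel P π) := by
  unfold stepKernel
  infer_instance

/-- The kernel that produces the state-action pair at time `n + 1` from the history up to time
`n`, which depends on the history only through the pair at time `n`. -/
def historyKernel {S A : Type} [MeasurableSpace S] [Fintype A] [MeasurableSpace A]
    (P : TransitionKernel S A) (π : Policy S A) (n : ℕ) :
    Kernel (Π _ : Finset.Iic n, S × A) (S × A) :=
  (stepKernel P π).comap (fun h => h ⟨n, Finset.mem_Iic.2 le_rfl⟩) (measurable_pi_apply _)

instance instIsMarkovKernelHistoryKernel {S A : Type} [MeasurableSpace S] [Fintype A]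
    [MeasurableSpace A] (P : TransitionKernel S A) (π : Policy S A) (n : ℕ) :
    IsMarkovKernel (historyKernel P π n) := by
  unfold historyKernel
  infer_instance

/-- The law of the process `(S_t, A_t)_{t ≥ 0}` induced by `π` and `P` given `S_0 = s`, from the
Ionescu-Tulcea theorem. -/
def processLaw {S A : Type} [MeasurableSpace S] [Fintype A] [MeasurableSpace A]
    (P : TransitionKernel S A) (π : Policy S A) (s : S) : Measure (ℕ → S × A) :=
  Kernel.trajMeasure (X := fun _ => S × A)
    ((Measure.dirac s).prod (actionKernel π s)) (historyKernel P π)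

/-- The value function `V_π^P(s) = E_π^P [∑_{t ≥ 0} γ^t r(S_t, A_t) | S_0 = s]`. -/
def value {S A : Type} [MeasurableSpace S] [Fintype A] [MeasurableSpace A] (γ : ℝ)
    (r : S → A → ℝ) (P : TransitionKernel S A) (π : Policy S A) (s : S) : ℝ :=
  ∫ x, ∑' t : ℕ, γ ^ t * r (x t).1 (x t).2 ∂(processLaw P π s)

/-- The robust value function `V_π(s) = inf_{P ∈ Amb} V_π^P(s)`. -/
def robustValue {S A : Type} [MeasurableSpace S] [Fintype A] [MeasurableSpace A] (γ : ℝ)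
    (r : S → A → ℝ) (Amb : Set (TransitionKernel S A)) (π : Policy S A) (s : S) : ℝ :=
  ⨅ P : Amb, value γ r P.1 π s

end Value

end RobustMDP

end

/-! Optimal choices in one Bellman step are made state by state, then glued by measurable selection.
For `v` bounded and continuous, the one-step objective is jointly continuous in the state, the mixed
action and the weight vector `w`. Since `W` and the action simplex are compact, the minimum over `W`
is continuous in state and action, and its maximum over the simplex is continuous in the state.
`exists_measurable_argmin` picks minimizing weights and maximizing actions measurably. Because the
ambiguity set is `s`-rectangular, the selected weights define an admissible kernel, so the infimum
over kernels and the supremum over policies become pointwise optimizations. Comparing the selected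
choices for two functions shows that the Bellman operator is a `γ`-contraction, and Banach's theorem
gives the fixed point.

The fixed point is tied to the values of the process by `hasSum_value_sub`: value minus `u` is the
discounted sum of expected residuals `T_π^P u - u`. A sign of the residual therefore becomes a
comparison of `u` with the value. For `u = v*`, a kernel that is worst for `v*` under an arbitrary
policy bounds the robust value of that policy above by `v*`; under the maximizing policy every
admissible kernel has value at least `v*`. This only needs measurable policies and kernels. -/

namespace RobustMDP

/-! ### Measurable selection of minimizers -/

section Selection

variable {X Y : Type*} [MeasurableSpace X] {f : X → Y → ℝ}

/-- The infimum of a Carathéodory function over a compact separable space is measurable. -/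
theorem measurable_iInf_of_compact [TopologicalSpace Y] [CompactSpace Y] [Nonempty Y]
    [TopologicalSpace.SeparableSpace Y] (hm : ∀ y, Measurable (fun x => f x y))
    (hc : ∀ x, Continuous (f x)) : Measurable (fun x => ⨅ y, f x y) := by
  refine measurable_of_Iio fun t => ?_
  -- By continuity, strict sublevel sets in `y` are open, so a nonempty one meets the countable
  -- dense sequence.
  have key : (fun x => ⨅ y, f x y) ⁻¹' Set.Iio t =
      ⋃ n, {x | f x (TopologicalSpace.denseSeq Y n) < t} := by
    ext x
    simp only [Set.mem_preimage, Set.mem_Iio, Set.mem_iUnion, Set.mem_ofPred_eq]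
    have hb : BddBelow (Set.range (f x)) := (isCompact_range (hc x)).bddBelow
    constructor
    · intro h
      obtain ⟨y, hy⟩ := exists_lt_of_ciInf_lt h
      obtain ⟨n, hn⟩ := (TopologicalSpace.denseRange_denseSeq Y).exists_mem_open
        (isOpen_Iio.preimage (hc x)) ⟨y, hy⟩
      exact ⟨n, hn⟩
    · rintro ⟨n, hn⟩
      exact (ciInf_le hb _).trans_lt hn
  rw [key]
  exact MeasurableSet.iUnion fun n => measurableSet_lt (hm _) measurable_const

/-- The order of the line makes the choice canonical: the smallest minimizer is taken. It lies in
`(-∞, t]` exactly when the minimum over `C ∩ (-∞, t]` does not exceed the minimum over `C`, a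
comparison of two measurable functions. -/
theorem exists_measurable_argmin_real {C : Set ℝ} (hC : IsCompact C) (hne : C.Nonempty)
    {f : X → C → ℝ} (hm : ∀ y, Measurable (fun x => f x y)) (hc : ∀ x, Continuous (f x)) :
    ∃ g : X → C, Measurable g ∧ ∀ x y, f x (g x) ≤ f x y := by
  have : CompactSpace C := isCompact_iff_compactSpace.1 hC
  have : Nonempty C := hne.to_subtype
  have hex : ∀ x, ∃ y, IsLeast {y : C | ∀ z, f x y ≤ f x z} y := by
    intro x
    have hcl : IsClosed {y : C | ∀ z, f x y ≤ f x z} := by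
      simp only [Set.ofPred_forall]
      exact isClosed_iInter fun z => isClosed_le (hc x) continuous_const
    refine hcl.isCompact.exists_isLeast ?_
    obtain ⟨y, -, hy⟩ := isCompact_univ.exists_isMinOn Set.univ_nonempty (hc x).continuousOn
    exact ⟨y, fun z => hy (Set.mem_univ z)⟩
  choose g hg using hex
  refine ⟨g, ?_, fun x => (hg x).1⟩
  suffices Measurable (fun x => (g x : ℝ)) from this.subtype_mk
  refine measurable_of_Iic fun t => ?_
  -- An empty real infimum is `0` by convention, so the comparison of minima is meaningful only when
  -- `C` has a point below `t`.
  by_cases ht : Nonempty {y : C // (y : ℝ) ≤ t}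
  · have : CompactSpace {y : C // (y : ℝ) ≤ t} :=
      isCompact_iff_compactSpace.1
        (isClosed_le continuous_subtype_val continuous_const :
          IsClosed {y : C | (y : ℝ) ≤ t}).isCompact
    have key : (fun x => (g x : ℝ)) ⁻¹' Set.Iic t =
        {x | (⨅ y : {y : C // (y : ℝ) ≤ t}, f x y) ≤ ⨅ z, f x z} := by
      ext x
      simp only [Set.mem_preimage, Set.mem_Iic, Set.mem_ofPred_eq]
      have hcy : Continuous fun y : {y : C // (y : ℝ) ≤ t} => f x y :=
        (hc x).comp continuous_subtype_val
      constructor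
      · intro h
        refine (ciInf_le (isCompact_range hcy).bddBelow ⟨g x, h⟩).trans (le_ciInf (hg x).1)
      · intro h
        obtain ⟨y, -, hy⟩ := isCompact_univ.exists_isMinOn Set.univ_nonempty hcy.continuousOn
        refine le_trans ?_ y.2
        refine (hg x).2 fun z => ?_
        have h1 : f x y ≤ ⨅ y : {y : C // (y : ℝ) ≤ t}, f x y :=
          le_ciInf fun w => hy (Set.mem_univ w)
        exact (h1.trans h).trans (ciInf_le (isCompact_range (hc x)).bddBelow z)
    rw [key]
    exact measurableSet_le
      (measurable_iInf_of_compact (fun y => hm y.1) fun x => (hc x).comp continuous_subtype_val)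
      (measurable_iInf_of_compact hm hc)
  · have key : (fun x => (g x : ℝ)) ⁻¹' Set.Iic t = ∅ :=
      Set.eq_empty_iff_forall_notMem.2 fun x hx => ht ⟨⟨g x, hx⟩⟩
    rw [key]
    exact MeasurableSet.empty

/-- A Carathéodory function with a compact metric second argument has a measurable minimizer. -/
theorem exists_measurable_argmin [MetricSpace Y] [CompactSpace Y] [Nonempty Y]
    [MeasurableSpace Y] [BorelSpace Y] (hm : ∀ y, Measurable (fun x => f x y))
    (hc : ∀ x, Continuous (f x)) :
    ∃ g : X → Y, Measurable g ∧ ∀ x y, f x (g x) ≤ f x y := by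
  -- A compact metric space is a continuous image of the Cantor set; minimizing over the Cantor set
  -- inside `ℝ` and pushing forward reduces to the real case.
  obtain ⟨φ, hφ, hsurj⟩ := exists_nat_bool_continuous_surjective_of_compact Y
  have hψ : Continuous fun c : cantorSet => φ (cantorSetHomeomorphNatToBool c) :=
    hφ.comp cantorSetHomeomorphNatToBool.continuous
  obtain ⟨g, hg, hmin⟩ := exists_measurable_argmin_real isCompact_cantorSet
    ⟨0, zero_mem_cantorSet⟩ (f := fun x c => f x (φ (cantorSetHomeomorphNatToBool c)))
    (fun c => hm _) (fun x => (hc x).comp hψ)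
  refine ⟨fun x => φ (cantorSetHomeomorphNatToBool (g x)), hψ.measurable.comp hg, fun x y => ?_⟩
  obtain ⟨b, rfl⟩ := hsurj y
  simpa using hmin x (cantorSetHomeomorphNatToBool.symm b)

end Selection

/-! ### Marginal laws of the state-action process -/

section MarginalLaws

variable {S A : Type} [MeasurableSpace S] [Fintype A] [MeasurableSpace A]

theorem isProbabilityMeasure_processLaw (P : TransitionKernel S A) (π : Policy S A) (s : S) :
    IsProbabilityMeasure (processLaw P π s) := by
  unfold processLaw
  infer_instance

/-- The law of `(S_n, A_n)` given `S_0 = s`. -/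
noncomputable def stateActionLaw (P : TransitionKernel S A) (π : Policy S A) (s : S) (n : ℕ) :
    Measure (S × A) :=
  (processLaw P π s).map (fun x => x n)

instance instIsProbabilityMeasureStateActionLaw (P : TransitionKernel S A) (π : Policy S A)
    (s : S) (n : ℕ) : IsProbabilityMeasure (stateActionLaw P π s n) := by
  have := isProbabilityMeasure_processLaw P π s
  exact Measure.isProbabilityMeasure_map (measurable_pi_apply n).aemeasurable

theorem stateActionLaw_zero (P : TransitionKernel S A) (π : Policy S A) (s : S) :
    stateActionLaw P π s 0 = (Measure.dirac s).prod (actionKernel π s) := by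
  unfold stateActionLaw processLaw Kernel.trajMeasure
  have h0 : (fun x : ℕ → S × A => x 0) =
      (fun y : (Π _ : Finset.Iic 0, S × A) => y ⟨0, by simp⟩) ∘
        (Preorder.frestrictLe (π := fun _ => S × A) 0) := by
    ext x <;> rfl
  rw [h0, ← Measure.map_map (by fun_prop) (by fun_prop), Measure.map_comp _ _ (by fun_prop),
    Kernel.traj_map_frestrictLe, Kernel.partialTraj_self, Measure.id_comp,
    Measure.map_map (by fun_prop) (by fun_prop)]
  exact Measure.map_id

/-- The kernel from the history reads only its last coordinate, so the one-time marginals form a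
Markov recursion. It is obtained as the second marginal of the joint law of the history and the next
pair. -/
theorem stateActionLaw_succ (P : TransitionKernel S A) (π : Policy S A) (s : S) (n : ℕ) :
    stateActionLaw P π s (n + 1) = (stateActionLaw P π s n).bind (stepKernel P π) := by
  have h := Kernel.map_frestrictLe_trajMeasure_compProd_eq_map_trajMeasure
    (X := fun _ => S × A) (μ₀ := (Measure.dirac s).prod (actionKernel π s))
    (κ := historyKernel P π) (a := n)
  have h2 := congrArg Measure.snd h
  rw [Measure.snd_compProd, Measure.snd_map_prodMk (by fun_prop)] at h2
  unfold stateActionLaw processLaw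
  rw [← h2]
  have h1 : (fun x : ℕ → S × A => x n) =
      (fun y : (Π _ : Finset.Iic n, S × A) => y ⟨n, by simp⟩) ∘
        (Preorder.frestrictLe (π := fun _ => S × A) n) := by
    ext x <;> rfl
  rw [h1, ← Measure.map_map (by fun_prop) (by fun_prop), historyKernel]
  set ν := Measure.map (Preorder.frestrictLe (π := fun _ => S × A) n) _
  ext B hB
  rw [Measure.bind_apply hB (Kernel.aemeasurable _), Measure.bind_apply hB (Kernel.aemeasurable _),
    lintegral_map (Kernel.measurable_coe _ hB) (measurable_pi_apply _)]
  rfl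

theorem integral_actionKernel [DiscreteMeasurableSpace A] (π : Policy S A) (s : S) (g : A → ℝ) :
    ∫ a, g a ∂(actionKernel π s) = ∑ a, (π.1 s).1 a * g a := by
  change ∫ a, g a ∂(simplexMeasure (π.1 s)) = _
  unfold simplexMeasure
  rw [integral_finsetSum_measure]
  · refine Finset.sum_congr rfl fun a _ => ?_
    rw [integral_smul_measure, integral_dirac, ENNReal.toReal_ofReal ((π.1 s).2.1 a), smul_eq_mul]
  · intro a _
    exact (integrable_dirac (by simp)).smul_measure ENNReal.ofReal_ne_top

end MarginalLaws

/-! ### Values as discounted sums of Bellman residuals -/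

section PerformanceDifference

variable {S A : Type} [MeasurableSpace S]

theorem integrable_of_measurable_bounded {μ : Measure S} [IsFiniteMeasure μ] {g : S → ℝ}
    (hg : Measurable g) {C : ℝ} (hC : ∀ z, |g z| ≤ C) : Integrable g μ :=
  Integrable.of_bound hg.aestronglyMeasurable C (ae_of_all _ hC)

theorem integral_bind_kernel {B : Type} [MeasurableSpace B] {μ : Measure S} [SFinite μ]
    {κ : Kernel S B} [IsSFiniteKernel κ] {g : B → ℝ} (hg : Integrable g (μ.bind κ)) :
    ∫ z, g z ∂(μ.bind κ) = ∫ x, ∫ z, g z ∂(κ x) ∂μ := by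
  rw [Measure.comp_eq_comp_const_apply] at hg ⊢
  rw [Kernel.integral_comp hg, Kernel.const_apply]

variable [Fintype A] [MeasurableSpace A]

theorem integral_stateActionLaw_succ_fst (P : TransitionKernel S A) (π : Policy S A) (s : S)
    (n : ℕ) {u : S → ℝ} (hu : Measurable u) {C : ℝ} (hC : ∀ z, |u z| ≤ C) :
    ∫ z, u z.1 ∂(stateActionLaw P π s (n + 1)) =
      ∫ z, ∫ s', u s' ∂(P.1 z) ∂(stateActionLaw P π s n) := by
  have hu1 : Measurable fun z : S × A => u z.1 := hu.comp measurable_fst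
  have hC1 : ∀ z : S × A, |u z.1| ≤ C := fun z => hC z.1
  rw [stateActionLaw_succ, integral_bind_kernel (integrable_of_measurable_bounded hu1 hC1)]
  congr 1
  ext z
  unfold stepKernel
  rw [ProbabilityTheory.integral_compProd (integrable_of_measurable_bounded hu1 hC1)]
  simp

variable [DiscreteMeasurableSpace A]

theorem measurable_uncurry_of_discrete {r : S → A → ℝ} (hrm : ∀ a, Measurable fun s => r s a) :
    Measurable fun z : S × A => r z.1 z.2 :=
  measurable_from_prod_countable_left hrm

/-- The value function as the discounted sum of the expected rewards. -/
theorem hasSum_value {γ : ℝ} {r : S → A → ℝ} (hγ0 : 0 < γ) (hγ1 : γ < 1)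
    (hrm : ∀ a, Measurable fun s => r s a) (hr : ∀ s a, |r s a| ≤ 1)
    (P : TransitionKernel S A) (π : Policy S A) (s : S) :
    HasSum (fun n : ℕ => γ ^ n * ∫ z, r z.1 z.2 ∂(stateActionLaw P π s n)) (value γ r P π s) := by
  have := isProbabilityMeasure_processLaw P π s
  have hm := measurable_uncurry_of_discrete hrm
  have hmn : ∀ n : ℕ, Measurable fun x : ℕ → S × A => γ ^ n * r (x n).1 (x n).2 := fun n =>
    (hm.comp (measurable_pi_apply n)).const_mul _
  have hbd : ∀ (n : ℕ) (x : ℕ → S × A), ‖γ ^ n * r (x n).1 (x n).2‖ ≤ γ ^ n := by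
    intro n x
    rw [norm_mul, Real.norm_of_nonneg (pow_nonneg hγ0.le n)]
    exact mul_le_of_le_one_right (pow_nonneg hγ0.le n) (hr _ _)
  have hint : ∀ n : ℕ, Integrable (fun x : ℕ → S × A => γ ^ n * r (x n).1 (x n).2)
      (processLaw P π s) := fun n =>
    Integrable.of_bound (hmn n).aestronglyMeasurable (γ ^ n) (ae_of_all _ (hbd n))
  -- Exchange of sum and expectation, justified by the geometric bound `γ ^ n` on the `n`-th term.
  have h := hasSum_integral_of_summable_integral_norm hint ?_
  · have hterm : (fun n : ℕ => γ ^ n * ∫ z, r z.1 z.2 ∂(stateActionLaw P π s n)) =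
        fun n => ∫ x, γ ^ n * r (x n).1 (x n).2 ∂(processLaw P π s) := by
      ext n
      rw [integral_const_mul, stateActionLaw,
        integral_map (measurable_pi_apply n).aemeasurable hm.aestronglyMeasurable]
    rw [hterm]
    exact h
  · refine Summable.of_nonneg_of_le (fun n => integral_nonneg fun x => norm_nonneg _) (fun n => ?_)
      (summable_geometric_of_lt_one hγ0.le hγ1)
    calc ∫ x, ‖γ ^ n * r (x n).1 (x n).2‖ ∂(processLaw P π s)
        ≤ ∫ _, γ ^ n ∂(processLaw P π s) :=
          integral_mono (hint n).norm (integrable_const _) (hbd n)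
      _ = γ ^ n := by simp

variable [MeasurableSingletonClass S]

/-- Conditionally on `S_n`, the action `A_n` has law `π(· | S_n)`. -/
theorem integral_stateActionLaw_eq (P : TransitionKernel S A) (π : Policy S A) (s : S) (n : ℕ)
    {g : S × A → ℝ} (hg : Measurable g) {C : ℝ} (hC : ∀ z, |g z| ≤ C) :
    ∫ z, g z ∂(stateActionLaw P π s n) =
      ∫ z, ∑ a, (π.1 z.1).1 a * g (z.1, a) ∂(stateActionLaw P π s n) := by
  have hG : Measurable fun z : S × A => ∑ a, (π.1 z.1).1 a * g (z.1, a) := by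
    refine Finset.measurable_sum _ fun a _ => ?_
    refine Measurable.mul ?_ (hg.comp (measurable_fst.prodMk measurable_const))
    exact ((measurable_pi_apply a).comp (measurable_subtype_coe.comp π.2)).comp measurable_fst
  have hGC : ∀ z : S × A, |∑ a, (π.1 z.1).1 a * g (z.1, a)| ≤ C := by
    intro z
    calc |∑ a, (π.1 z.1).1 a * g (z.1, a)| ≤ ∑ a, |(π.1 z.1).1 a * g (z.1, a)| :=
          Finset.abs_sum_le_sum_abs _ _
      _ ≤ ∑ a, (π.1 z.1).1 a * C := by
          refine Finset.sum_le_sum fun a _ => ?_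
          rw [abs_mul, abs_of_nonneg ((π.1 z.1).2.1 a)]
          exact mul_le_mul_of_nonneg_left (hC _) ((π.1 z.1).2.1 a)
      _ = C := by rw [← Finset.sum_mul, (π.1 z.1).2.2, one_mul]
  -- No induction is needed: both the initial law and each step draw the action from `π` last.
  cases n with
  | zero =>
    rw [stateActionLaw_zero, integral_prod _ (integrable_of_measurable_bounded hg hC),
      integral_prod _ (integrable_of_measurable_bounded hG hGC), integral_dirac, integral_dirac,
      integral_actionKernel]
    simp
  | succ n =>
    rw [stateActionLaw_succ, integral_bind_kernel (integrable_of_measurable_bounded hg hC),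
      integral_bind_kernel (integrable_of_measurable_bounded hG hGC)]
    congr 1
    ext z
    unfold stepKernel
    rw [ProbabilityTheory.integral_compProd (integrable_of_measurable_bounded hg hC),
      ProbabilityTheory.integral_compProd (integrable_of_measurable_bounded hG hGC)]
    congr 1
    ext s'
    rw [Kernel.prodMkLeft_apply, integral_actionKernel]
    simp

variable {γ : ℝ} {r : S → A → ℝ}

/-- The difference between the value of a stationary pair and a bounded function `u` is the
discounted sum of the expected one-step residuals `T_π^P u - u` along the process. -/
theorem hasSum_value_sub (hγ0 : 0 < γ) (hγ1 : γ < 1) (hrm : ∀ a, Measurable fun s => r s a)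
    (hr : ∀ s a, |r s a| ≤ 1) (P : TransitionKernel S A) (π : Policy S A) {u : S → ℝ}
    (hu : Measurable u) {C : ℝ} (hC : ∀ s, |u s| ≤ C) (s : S) :
    HasSum (fun n : ℕ => γ ^ n * ∫ z, (evalOp γ r P π u z.1 - u z.1) ∂(stateActionLaw P π s n))
      (value γ r P π s - u s) := by
  have hm := measurable_uncurry_of_discrete hrm
  have hPu : Measurable fun z : S × A => ∫ s', u s' ∂(P.1 z) :=
    (hu.stronglyMeasurable.integral_kernel (κ := P.1)).measurable
  have hPuC : ∀ z : S × A, |∫ s', u s' ∂(P.1 z)| ≤ C := fun z => by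
    have := norm_integral_le_of_norm_le_const (μ := P.1 z) (f := u) (C := C) (ae_of_all _ hC)
    simpa using this
  have hu1 : Measurable fun z : S × A => u z.1 := hu.comp measurable_fst
  have hC1 : ∀ z : S × A, |u z.1| ≤ C := fun z => hC z.1
  have hr1 : ∀ z : S × A, |r z.1 z.2| ≤ 1 := fun z => hr z.1 z.2
  set h : S × A → ℝ := fun z => r z.1 z.2 + γ * ∫ s', u s' ∂(P.1 z) with hdef
  have hhm : Measurable h := hm.add (hPu.const_mul γ)
  have hhC : ∀ z, |h z| ≤ 1 + γ * C := fun z => by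
    refine (abs_add_le _ _).trans (add_le_add (hr1 z) ?_)
    rw [abs_mul, abs_of_pos hγ0]
    exact mul_le_mul_of_nonneg_left (hPuC z) hγ0.le
  set U : ℕ → ℝ := fun n => ∫ z, u z.1 ∂(stateActionLaw P π s n) with hU
  -- Averaging over the action and then moving one step along the process turns each residual into
  -- an expected reward plus `γ * U (n + 1) - U n`, which telescopes after discounting.
  have hres : ∀ n, ∫ z, (evalOp γ r P π u z.1 - u z.1) ∂(stateActionLaw P π s n) =
      (∫ z, r z.1 z.2 ∂(stateActionLaw P π s n)) + γ * U (n + 1) - U n := by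
    intro n
    have hev : (fun z : S × A => evalOp γ r P π u z.1) =
        fun z => ∑ a, (π.1 z.1).1 a * h (z.1, a) := rfl
    have hevm : Measurable fun z : S × A => evalOp γ r P π u z.1 := by
      rw [hev]
      refine Finset.measurable_sum _ fun a _ => ?_
      refine Measurable.mul ?_ (hhm.comp (measurable_fst.prodMk measurable_const))
      exact ((measurable_pi_apply a).comp (measurable_subtype_coe.comp π.2)).comp measurable_fst
    have hevC : ∀ z : S × A, |evalOp γ r P π u z.1| ≤ 1 + γ * C := by
      intro z
      calc |∑ a, (π.1 z.1).1 a * h (z.1, a)| ≤ ∑ a, |(π.1 z.1).1 a * h (z.1, a)| :=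
            Finset.abs_sum_le_sum_abs _ _
        _ ≤ ∑ a, (π.1 z.1).1 a * (1 + γ * C) := by
            refine Finset.sum_le_sum fun a _ => ?_
            rw [abs_mul, abs_of_nonneg ((π.1 z.1).2.1 a)]
            exact mul_le_mul_of_nonneg_left (hhC _) ((π.1 z.1).2.1 a)
        _ = 1 + γ * C := by rw [← Finset.sum_mul, (π.1 z.1).2.2, one_mul]
    rw [integral_sub (integrable_of_measurable_bounded hevm hevC)
      (integrable_of_measurable_bounded hu1 hC1), hev, ← integral_stateActionLaw_eq P π s n hhm hhC,
      hdef, integral_add (integrable_of_measurable_bounded hm hr1)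
      ((integrable_of_measurable_bounded hPu hPuC).const_mul γ), integral_const_mul,
      ← integral_stateActionLaw_succ_fst P π s n hu hC]
  have hU0 : U 0 = u s := by
    rw [hU]
    simp only
    rw [stateActionLaw_zero, integral_prod _ (integrable_of_measurable_bounded hu1 hC1),
      integral_dirac]
    simp
  have hsum : Summable fun n => γ ^ n * U n := by
    refine Summable.of_norm_bounded
      ((summable_geometric_of_lt_one hγ0.le hγ1).mul_right C) fun n => ?_
    rw [norm_mul, Real.norm_of_nonneg (pow_nonneg hγ0.le n)]
    refine mul_le_mul_of_nonneg_left ?_ (pow_nonneg hγ0.le n)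
    have := norm_integral_le_of_norm_le_const (μ := stateActionLaw P π s n)
      (f := fun z => u z.1) (C := C) (ae_of_all _ hC1)
    simpa using this
  have h1 := hsum.hasSum
  -- The shifted series `γ ^ (n + 1) * U (n + 1)` misses only the term `U 0 = u s`, which is what
  -- survives the telescoping.
  have h2 := (hasSum_nat_add_iff' 1).2 h1
  have h3 := (hasSum_value hγ0 hγ1 hrm hr P π s).add (h2.sub h1)
  convert h3 using 1
  · ext n
    rw [hres n]
    ring
  · simp [hU0]
    ring

/-- All residuals in `hasSum_value_sub` are nonpositive, so their discounted sum is too. -/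
theorem value_le_of_evalOp_le (hγ0 : 0 < γ) (hγ1 : γ < 1) (hrm : ∀ a, Measurable fun s => r s a)
    (hr : ∀ s a, |r s a| ≤ 1) {P : TransitionKernel S A} {π : Policy S A} {u : S → ℝ}
    (hu : Measurable u) {C : ℝ} (hC : ∀ s, |u s| ≤ C) (h : ∀ s, evalOp γ r P π u s ≤ u s) (s : S) :
    value γ r P π s ≤ u s := by
  have hs := hasSum_value_sub hγ0 hγ1 hrm hr P π hu hC s
  refine sub_nonpos.1 (hasSum_le (fun n => ?_) hs hasSum_zero)
  exact mul_nonpos_of_nonneg_of_nonpos (pow_nonneg hγ0.le n)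
    (integral_nonpos fun z => sub_nonpos.2 (h z.1))

theorem le_value_of_le_evalOp (hγ0 : 0 < γ) (hγ1 : γ < 1) (hrm : ∀ a, Measurable fun s => r s a)
    (hr : ∀ s a, |r s a| ≤ 1) {P : TransitionKernel S A} {π : Policy S A} {u : S → ℝ}
    (hu : Measurable u) {C : ℝ} (hC : ∀ s, |u s| ≤ C) (h : ∀ s, u s ≤ evalOp γ r P π u s) (s : S) :
    u s ≤ value γ r P π s := by
  have hs := hasSum_value_sub hγ0 hγ1 hrm hr P π hu hC s
  refine sub_nonneg.1 (hasSum_le (fun n => ?_) hasSum_zero hs)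
  exact mul_nonneg (pow_nonneg hγ0.le n) (integral_nonneg fun z => sub_nonneg.2 (h z.1))

end PerformanceDifference

/-! ### Estimates for the one-step objective -/

section EvaluationOperator

variable {S A : Type} [TopologicalSpace S] [MeasurableSpace S] [Fintype A]
  {γ : ℝ} {r : S → A → ℝ}

/-- Averaging over actions and next states costs nothing, so only the factor `γ` remains. The
one-sided form can be inserted between optimal choices made for different functions. -/
theorem oneStep_le_add [OpensMeasurableSpace S] (hγ0 : 0 < γ) (v w : S →ᵇ ℝ) (s : S)
    (p : stdSimplex ℝ A) (Q : A → Measure S) [∀ a, IsProbabilityMeasure (Q a)] :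
    oneStep γ r v s p Q ≤ oneStep γ r w s p Q + γ * ‖v - w‖ := by
  have h1 : ∀ a, ∫ s', v s' ∂(Q a) ≤ ∫ s', w s' ∂(Q a) + ‖v - w‖ := by
    intro a
    rw [← sub_le_iff_le_add', ← integral_sub (v.integrable _) (w.integrable _)]
    have h := norm_integral_le_of_norm_le_const (μ := Q a) (f := fun s' => v s' - w s')
      (C := ‖v - w‖) (ae_of_all _ fun s' => (v - w).norm_coe_le_norm s')
    rw [probReal_univ, mul_one] at h
    exact (le_abs_self _).trans h
  unfold oneStep
  calc ∑ a, p.1 a * (r s a + γ * ∫ s', v s' ∂(Q a))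
      ≤ ∑ a, (p.1 a * (r s a + γ * ∫ s', w s' ∂(Q a)) + p.1 a * (γ * ‖v - w‖)) := by
        refine Finset.sum_le_sum fun a _ => ?_
        rw [← mul_add]
        refine mul_le_mul_of_nonneg_left ?_ (p.2.1 a)
        have := mul_le_mul_of_nonneg_left (h1 a) hγ0.le
        linarith
    _ = _ := by rw [Finset.sum_add_distrib, ← Finset.sum_mul, p.2.2, one_mul]

theorem abs_oneStep_le (hγ0 : 0 < γ) (hr : ∀ s a, |r s a| ≤ 1) (v : S →ᵇ ℝ) (s : S)
    (p : stdSimplex ℝ A) (Q : A → Measure S) [∀ a, IsProbabilityMeasure (Q a)] :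
    |oneStep γ r v s p Q| ≤ 1 + γ * ‖v‖ := by
  unfold oneStep
  calc |∑ a, p.1 a * (r s a + γ * ∫ s', v s' ∂(Q a))|
      ≤ ∑ a, |p.1 a * (r s a + γ * ∫ s', v s' ∂(Q a))| := Finset.abs_sum_le_sum_abs _ _
    _ ≤ ∑ a, p.1 a * (1 + γ * ‖v‖) := by
        refine Finset.sum_le_sum fun a _ => ?_
        rw [abs_mul, abs_of_nonneg (p.2.1 a)]
        refine mul_le_mul_of_nonneg_left ((abs_add_le _ _).trans (add_le_add (hr s a) ?_)) (p.2.1 a)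
        rw [abs_mul, abs_of_pos hγ0]
        refine mul_le_mul_of_nonneg_left ?_ hγ0.le
        have h := norm_integral_le_of_norm_le_const (μ := Q a) (f := v)
          (C := ‖v‖) (ae_of_all _ fun s' => v.norm_coe_le_norm s')
        rwa [probReal_univ, mul_one] at h
    _ = _ := by rw [← Finset.sum_mul, p.2.2, one_mul]

end EvaluationOperator

/-! ### Mixture kernels and continuity in the weights -/

section Mixture

variable {S A : Type} [MeasurableSpace S] [MeasurableSpace A] {K : ℕ}

/-- The kernel `(x, a) ↦ ∑ₖ wₖ(x) Pₖ(· | σ(x), a)` with measurable weights. -/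
noncomputable def mixtureKernel {X : Type} [MeasurableSpace X] (Pgen : Fin K → TransitionKernel S A)
    {σ : X → S} (hσ : Measurable σ) {w : X → Fin K → ℝ} (hw : Measurable w) : Kernel (X × A) S where
  toFun z := ∑ k, ENNReal.ofReal (w z.1 k) • (Pgen k).1 (σ z.1, z.2)
  measurable' := by
    refine Measure.measurable_of_measurable_coe _ fun B hB => ?_
    simp only [Measure.finsetSum_apply, Measure.smul_apply, smul_eq_mul]
    refine Finset.measurable_sum _ fun k _ => Measurable.mul ?_ ?_
    · exact ENNReal.measurable_ofReal.comp
        ((measurable_pi_apply k).comp (hw.comp measurable_fst))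
    · exact (Kernel.measurable_coe (Pgen k).1 hB).comp
        ((hσ.comp measurable_fst).prodMk measurable_snd)

theorem isMarkovKernel_mixtureKernel {X : Type} [MeasurableSpace X]
    (Pgen : Fin K → TransitionKernel S A) {σ : X → S} (hσ : Measurable σ) {w : X → Fin K → ℝ}
    (hw : Measurable w) (hws : ∀ x, w x ∈ stdSimplex ℝ (Fin K)) :
    IsMarkovKernel (mixtureKernel Pgen hσ hw) := by
  refine ⟨fun z => ⟨?_⟩⟩
  change (∑ k, ENNReal.ofReal (w z.1 k) • (Pgen k).1 (σ z.1, z.2)) Set.univ = 1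
  simp only [Measure.finsetSum_apply, Measure.smul_apply, measure_univ, smul_eq_mul, mul_one]
  rw [← ENNReal.ofReal_sum_of_nonneg fun k _ => (hws z.1).1 k, (hws z.1).2, ENNReal.ofReal_one]

variable [Fintype A]

/-- The one-step objective as a function of the mixture weights. -/
noncomputable def mixtureObjective (γ : ℝ) (r : S → A → ℝ) (Pgen : Fin K → TransitionKernel S A)
    (v : S → ℝ) (s : S) (p : stdSimplex ℝ A) (w : Fin K → ℝ) : ℝ :=
  ∑ a, p.1 a * (r s a + γ * ∑ k, w k * ∫ s', v s' ∂((Pgen k).1 (s, a)))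

variable [TopologicalSpace S] [OpensMeasurableSpace S] {γ : ℝ} {r : S → A → ℝ}

theorem oneStep_eq_mixtureObjective (Pgen : Fin K → TransitionKernel S A) (v : S →ᵇ ℝ) (s : S)
    (p : stdSimplex ℝ A) {w : Fin K → ℝ} (hw : ∀ k, 0 ≤ w k) {R : A → Measure S}
    (hR : ∀ a, R a = ∑ k, ENNReal.ofReal (w k) • (Pgen k).1 (s, a)) :
    oneStep γ r v s p R = mixtureObjective γ r Pgen v s p w := by
  unfold oneStep mixtureObjective
  refine Finset.sum_congr rfl fun a _ => ?_
  rw [hR a, integral_finsetSum_measure]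
  · congr 3
    refine Finset.sum_congr rfl fun k _ => ?_
    rw [integral_smul_measure, ENNReal.toReal_ofReal (hw k), smul_eq_mul]
  · exact fun k _ => (v.integrable _).smul_measure ENNReal.ofReal_ne_top

/-- Weak continuity of the generators makes each integral of `v` continuous in the state; the rest
is polynomial in the action probabilities and weights. -/
theorem continuous_mixtureObjective (hrc : ∀ a, Continuous fun s => r s a)
    {Pgen : Fin K → TransitionKernel S A} (hP : ∀ k, WeaklyContinuous (Pgen k)) (v : S →ᵇ ℝ) :
    Continuous fun z : (S × stdSimplex ℝ A) × (Fin K → ℝ) =>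
      mixtureObjective γ r Pgen v z.1.1 z.1.2 z.2 := by
  have hv : ∀ k a, Continuous fun s => ∫ s', v s' ∂((Pgen k).1 (s, a)) := fun k a =>
    (ProbabilityMeasure.continuous_integral_boundedContinuousFunction v).comp (hP k a)
  unfold mixtureObjective
  refine continuous_finsetSum _ fun a _ => Continuous.mul ?_ (Continuous.add ?_ ?_)
  · exact (continuous_apply a).comp
      (continuous_subtype_val.comp (continuous_snd.comp continuous_fst))
  · exact (hrc a).comp (continuous_fst.comp continuous_fst)
  · refine continuous_const.mul (continuous_finsetSum _ fun k _ => Continuous.mul ?_ ?_)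
    · exact (continuous_apply k).comp continuous_snd
    · exact (hv k a).comp (continuous_fst.comp continuous_fst)

end Mixture

/-! ### Measurable worst-case kernels and optimal policies -/

section Selectors

variable {S A : Type} [MeasurableSpace S] [Fintype A] [MeasurableSpace A] {K : ℕ} {γ : ℝ}
  {r : S → A → ℝ} {Pgen : Fin K → TransitionKernel S A} {W : Set (Fin K → ℝ)}

theorem exists_mem_mixtureAmbiguitySet_of_worstCaseKernel {v : S → ℝ}
    {Q : Kernel ((S × stdSimplex ℝ A) × A) S} [IsMarkovKernel Q]
    (hQ : ∀ (s : S) (p : stdSimplex ℝ A), (fun a => Q ((s, p), a)) ∈ mixtureMarginal W Pgen s ∧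
      ∀ R ∈ mixtureMarginal W Pgen s,
        oneStep γ r v s p (fun a => Q ((s, p), a)) ≤ oneStep γ r v s p R) (π : Policy S A) :
    ∃ P' ∈ mixtureAmbiguitySet W Pgen, (∀ s a, P'.1 (s, a) = Q ((s, π.1 s), a)) ∧
      ∀ s, evalOp γ r P' π v s = robustEvalOp γ r (mixtureAmbiguitySet W Pgen) π v s ∧
        ∀ P ∈ mixtureAmbiguitySet W Pgen, evalOp γ r P' π v s ≤ evalOp γ r P π v s := by
  have hm : Measurable fun z : S × A => ((z.1, π.1 z.1), z.2) :=
    (measurable_fst.prodMk (π.2.comp measurable_fst)).prodMk measurable_snd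
  let P' : TransitionKernel S A := ⟨Q.comap _ hm, inferInstance⟩
  have hP' : P' ∈ mixtureAmbiguitySet W Pgen := fun s => (hQ s (π.1 s)).1
  have hle : ∀ s, ∀ P ∈ mixtureAmbiguitySet W Pgen, evalOp γ r P' π v s ≤ evalOp γ r P π v s :=
    fun s P hP => (hQ s (π.1 s)).2 _ (hP s)
  refine ⟨P', hP', fun s a => rfl, fun s => ⟨?_, hle s⟩⟩
  -- Exhibiting an attained minimum also settles the lower bound that a real infimum requires.
  have hleast : IsLeast (Set.range fun P : mixtureAmbiguitySet W Pgen => evalOp γ r P.1 π v s)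
      (evalOp γ r P' π v s) := by
    refine ⟨⟨⟨P', hP'⟩, rfl⟩, ?_⟩
    rintro _ ⟨P, rfl⟩
    exact hle s P.1 P.2
  exact hleast.csInf_eq.symm

variable [TopologicalSpace S] [BorelSpace S]

theorem continuous_sInf_mixtureObjective (hrc : ∀ a, Continuous fun s => r s a)
    (hP : ∀ k, WeaklyContinuous (Pgen k)) (hWsub : W ⊆ stdSimplex ℝ (Fin K)) (hWc : IsClosed W)
    (v : S →ᵇ ℝ) :
    Continuous fun x : S × stdSimplex ℝ A => sInf (mixtureObjective γ r Pgen v x.1 x.2 '' W) :=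
  ((isCompact_stdSimplex ℝ (Fin K)).of_isClosed_subset hWc hWsub).continuous_sInf
    (f := fun (x : S × stdSimplex ℝ A) w => mixtureObjective γ r Pgen v x.1 x.2 w)
    (continuous_mixtureObjective hrc hP v)

/-- A measurable family of worst-case kernels for the one-step objective. -/
theorem exists_worstCaseKernel (hrc : ∀ a, Continuous fun s => r s a)
    (hP : ∀ k, WeaklyContinuous (Pgen k)) (hWsub : W ⊆ stdSimplex ℝ (Fin K)) (hWc : IsClosed W)
    (hWne : W.Nonempty) (v : S →ᵇ ℝ) :
    ∃ Q : Kernel ((S × stdSimplex ℝ A) × A) S, IsMarkovKernel Q ∧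
      ∀ (s : S) (p : stdSimplex ℝ A),
        (fun a => Q ((s, p), a)) ∈ mixtureMarginal W Pgen s ∧
        ∀ R ∈ mixtureMarginal W Pgen s,
          oneStep γ r v s p (fun a => Q ((s, p), a)) ≤ oneStep γ r v s p R := by
  have hWcomp : IsCompact W := (isCompact_stdSimplex ℝ (Fin K)).of_isClosed_subset hWc hWsub
  have : CompactSpace W := isCompact_iff_compactSpace.1 hWcomp
  have : Nonempty W := hWne.to_subtype
  have hcont := continuous_mixtureObjective (γ := γ) hrc hP v
  obtain ⟨g, hg, hmin⟩ := exists_measurable_argmin (X := S × stdSimplex ℝ A) (Y := W)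
    (f := fun x w => mixtureObjective γ r Pgen v x.1 x.2 w)
    (fun w => (hcont.comp (continuous_id.prodMk continuous_const)).measurable)
    (fun x => hcont.comp (continuous_const.prodMk continuous_subtype_val))
  have hw : Measurable fun x => (g x : Fin K → ℝ) := measurable_subtype_coe.comp hg
  refine ⟨mixtureKernel Pgen measurable_fst hw,
    isMarkovKernel_mixtureKernel Pgen _ hw fun x => hWsub (g x).2, fun s p => ⟨?_, ?_⟩⟩
  · exact ⟨g (s, p), (g (s, p)).2, fun a => rfl⟩
  · rintro R ⟨w, hwW, hR⟩
    rw [oneStep_eq_mixtureObjective Pgen v s p (hWsub hwW).1 hR,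
      oneStep_eq_mixtureObjective (R := fun a => mixtureKernel Pgen measurable_fst hw ((s, p), a))
        Pgen v s p (hWsub (g (s, p)).2).1 fun a => rfl]
    exact hmin (s, p) ⟨w, hwW⟩

/-- Rectangularity at work: the worst-case kernel is optimal at all states at once, so the infimum
over kernels decouples into a minimization over weights at each state. -/
theorem robustEvalOp_eq_sInf (hrc : ∀ a, Continuous fun s => r s a)
    (hP : ∀ k, WeaklyContinuous (Pgen k)) (hWsub : W ⊆ stdSimplex ℝ (Fin K)) (hWc : IsClosed W)
    (hWne : W.Nonempty) (v : S →ᵇ ℝ) (π : Policy S A) (s : S) :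
    robustEvalOp γ r (mixtureAmbiguitySet W Pgen) π v s =
      sInf (mixtureObjective γ r Pgen v s (π.1 s) '' W) := by
  obtain ⟨Q, hQm, hQ⟩ := exists_worstCaseKernel (γ := γ) hrc hP hWsub hWc hWne v
  obtain ⟨P', hP', hP'Q, hev⟩ := exists_mem_mixtureAmbiguitySet_of_worstCaseKernel hQ π
  rw [← (hev s).1]
  obtain ⟨w, hw, hPw⟩ := hP' s
  refine (IsLeast.csInf_eq (s := mixtureObjective γ r Pgen v s (π.1 s) '' W) ⟨?_, ?_⟩).symm
  · exact ⟨w, hw, (oneStep_eq_mixtureObjective Pgen v s _ (hWsub hw).1 hPw).symm⟩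
  · rintro _ ⟨w', hw', rfl⟩
    rw [← oneStep_eq_mixtureObjective Pgen v s _ (hWsub hw').1 fun a => rfl]
    have h1 := (hQ s (π.1 s)).2 (fun a => ∑ k, ENNReal.ofReal (w' k) • (Pgen k).1 (s, a))
      ⟨w', hw', fun a => rfl⟩
    have h2 : evalOp γ r P' π v s = oneStep γ r v s (π.1 s) fun a => Q ((s, π.1 s), a) := by
      unfold evalOp
      congr 1
      ext1 a
      exact hP'Q s a
    rw [h2]
    exact h1

/-- A policy that is optimal for one robust Bellman step. -/
theorem exists_optimalPolicy [Nonempty A] (hrc : ∀ a, Continuous fun s => r s a)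
    (hP : ∀ k, WeaklyContinuous (Pgen k)) (hWsub : W ⊆ stdSimplex ℝ (Fin K)) (hWc : IsClosed W)
    (hWne : W.Nonempty) (v : S →ᵇ ℝ) :
    ∃ π' : Policy S A, ∀ s,
      robustEvalOp γ r (mixtureAmbiguitySet W Pgen) π' v s =
        robustBellman γ r (mixtureAmbiguitySet W Pgen) v s ∧
      robustBellman γ r (mixtureAmbiguitySet W Pgen) v s =
        sSup ((fun p => sInf (mixtureObjective γ r Pgen v s p '' W)) ''
          (Set.univ : Set (stdSimplex ℝ A))) ∧
      ∀ π : Policy S A, robustEvalOp γ r (mixtureAmbiguitySet W Pgen) π v s ≤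
        robustBellman γ r (mixtureAmbiguitySet W Pgen) v s := by
  classical
  have hcont := continuous_sInf_mixtureObjective (A := A) (γ := γ) hrc hP hWsub hWc v
  have : Nonempty (stdSimplex ℝ A) :=
    ⟨⟨_, single_mem_stdSimplex ℝ (Classical.arbitrary A)⟩⟩
  -- The sign change turns the minimizer selection into a selection of maximizing mixed actions.
  obtain ⟨g, hg, hmax⟩ := exists_measurable_argmin (X := S) (Y := stdSimplex ℝ A)
    (f := fun s p => -sInf (mixtureObjective γ r Pgen v s p '' W))
    (fun p => (hcont.comp (continuous_id.prodMk continuous_const)).neg.measurable)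
    (fun s => (hcont.comp (continuous_const.prodMk continuous_id)).neg)
  have heq := robustEvalOp_eq_sInf (A := A) (γ := γ) hrc hP hWsub hWc hWne v
  have hgreat : ∀ s, IsGreatest (Set.range fun π : Policy S A =>
      robustEvalOp γ r (mixtureAmbiguitySet W Pgen) π v s)
      (robustEvalOp γ r (mixtureAmbiguitySet W Pgen) ⟨g, hg⟩ v s) := by
    refine fun s => ⟨⟨_, rfl⟩, ?_⟩
    rintro _ ⟨π, rfl⟩
    simp only [heq]
    exact neg_le_neg_iff.1 (hmax s (π.1 s))
  have hT : ∀ s, robustBellman γ r (mixtureAmbiguitySet W Pgen) v s =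
      robustEvalOp γ r (mixtureAmbiguitySet W Pgen) ⟨g, hg⟩ v s := fun s => (hgreat s).csSup_eq
  refine ⟨⟨g, hg⟩, fun s => ⟨(hT s).symm, ?_, fun π => ?_⟩⟩
  · rw [hT, heq]
    refine (IsGreatest.csSup_eq (s := (fun p => sInf (mixtureObjective γ r Pgen v s p '' W)) ''
      (Set.univ : Set (stdSimplex ℝ A))) ⟨⟨g s, trivial, rfl⟩, ?_⟩).symm
    rintro _ ⟨p, -, rfl⟩
    exact neg_le_neg_iff.1 (hmax s p)
  · rw [hT]
    exact (hgreat s).2 (Set.mem_range_self π)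

theorem continuous_robustBellman [Nonempty A] (hrc : ∀ a, Continuous fun s => r s a)
    (hP : ∀ k, WeaklyContinuous (Pgen k)) (hWsub : W ⊆ stdSimplex ℝ (Fin K)) (hWc : IsClosed W)
    (hWne : W.Nonempty) (v : S →ᵇ ℝ) :
    Continuous (robustBellman γ r (mixtureAmbiguitySet W Pgen) v) := by
  obtain ⟨π', hπ'⟩ := exists_optimalPolicy (γ := γ) hrc hP hWsub hWc hWne v
  have hcont := continuous_sInf_mixtureObjective (A := A) (γ := γ) hrc hP hWsub hWc v
  rw [funext fun s => (hπ' s).2.1]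
  exact isCompact_univ.continuous_sSup
    (f := fun (s : S) (p : stdSimplex ℝ A) => sInf (mixtureObjective γ r Pgen v s p '' W)) hcont

end Selectors

/-! ### Optimal pairs, contraction and upper bounds -/

section OptimalPairs

variable {S A : Type} [TopologicalSpace S] [MeasurableSpace S]
  [BorelSpace S] [Fintype A] [MeasurableSpace A] {K : ℕ} {γ : ℝ} {r : S → A → ℝ}
  {Pgen : Fin K → TransitionKernel S A} {W : Set (Fin K → ℝ)}

theorem robustValue_le_of_evalOp_le [MeasurableSingletonClass S] [DiscreteMeasurableSpace A]
    (hγ0 : 0 < γ) (hγ1 : γ < 1)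
    (hrc : ∀ a, Continuous fun s => r s a) (hr : ∀ s a, r s a ∈ Set.Icc (0 : ℝ) 1)
    {Amb : Set (TransitionKernel S A)} (u : S →ᵇ ℝ) {P : TransitionKernel S A} (hPA : P ∈ Amb)
    {π : Policy S A} (h : ∀ s, evalOp γ r P π u s ≤ u s) (s : S) :
    robustValue γ r Amb π s ≤ u s := by
  have hr' : ∀ s a, |r s a| ≤ 1 := fun s a => by
    rw [abs_of_nonneg (hr s a).1]
    exact (hr s a).2
  have hrm : ∀ a, Measurable fun s => r s a := fun a => (hrc a).measurable
  have hbdd : BddBelow (Set.range fun P : Amb => value γ r P.1 π s) := by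
    refine ⟨0, ?_⟩
    rintro _ ⟨P, rfl⟩
    -- Comparison with `u = 0` gives nonnegative values from nonnegative rewards, hence the lower
    -- bound needed for the infimum over kernels.
    refine le_value_of_le_evalOp hγ0 hγ1 hrm hr' (u := fun _ => 0) measurable_const (C := 0)
      (by simp) (fun s' => ?_) s
    unfold evalOp oneStep
    refine Finset.sum_nonneg fun a _ => mul_nonneg ((π.1 s').2.1 a) ?_
    simpa using (hr s' a).1
  exact (ciInf_le hbdd ⟨P, hPA⟩).trans (value_le_of_evalOp_le hγ0 hγ1 hrm hr'
    u.continuous.measurable u.norm_coe_le_norm h s)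

variable [Nonempty A]

/-- A worst-case kernel together with an optimal policy for one robust Bellman step. -/
theorem exists_optimalPair (hrc : ∀ a, Continuous fun s => r s a)
    (hP : ∀ k, WeaklyContinuous (Pgen k)) (hWsub : W ⊆ stdSimplex ℝ (Fin K)) (hWc : IsClosed W)
    (hWne : W.Nonempty) (v : S →ᵇ ℝ) :
    ∃ P' ∈ mixtureAmbiguitySet W Pgen, ∃ π' : Policy S A, ∀ s,
      evalOp γ r P' π' v s = robustEvalOp γ r (mixtureAmbiguitySet W Pgen) π' v s ∧
      evalOp γ r P' π' v s = robustBellman γ r (mixtureAmbiguitySet W Pgen) v s ∧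
      ∀ P ∈ mixtureAmbiguitySet W Pgen, evalOp γ r P' π' v s ≤ evalOp γ r P π' v s := by
  obtain ⟨π', hπ'⟩ := exists_optimalPolicy (γ := γ) hrc hP hWsub hWc hWne v
  obtain ⟨Q, hQm, hQ⟩ := exists_worstCaseKernel (γ := γ) hrc hP hWsub hWc hWne v
  obtain ⟨P', hP', -, hev⟩ := exists_mem_mixtureAmbiguitySet_of_worstCaseKernel hQ π'
  exact ⟨P', hP', π', fun s => ⟨(hev s).1, (hev s).1.trans (hπ' s).1, (hev s).2⟩⟩

theorem exists_evalOp_le_robustBellman (hrc : ∀ a, Continuous fun s => r s a)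
    (hP : ∀ k, WeaklyContinuous (Pgen k)) (hWsub : W ⊆ stdSimplex ℝ (Fin K)) (hWc : IsClosed W)
    (hWne : W.Nonempty) (v : S →ᵇ ℝ) (π : Policy S A) :
    ∃ P' ∈ mixtureAmbiguitySet W Pgen, ∀ s,
      evalOp γ r P' π v s ≤ robustBellman γ r (mixtureAmbiguitySet W Pgen) v s := by
  obtain ⟨π', hπ'⟩ := exists_optimalPolicy (γ := γ) hrc hP hWsub hWc hWne v
  obtain ⟨Q, hQm, hQ⟩ := exists_worstCaseKernel (γ := γ) hrc hP hWsub hWc hWne v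
  obtain ⟨P', hP', -, hev⟩ := exists_mem_mixtureAmbiguitySet_of_worstCaseKernel hQ π
  exact ⟨P', hP', fun s => (hev s).1.trans_le ((hπ' s).2.2 π)⟩

/-- The policy is taken optimal for `v` and the kernel worst for `w` under that policy; each choice
gives an inequality in the needed direction, and only the change from `v` to `w` costs anything. -/
theorem robustBellman_le_add (hγ0 : 0 < γ) (hrc : ∀ a, Continuous fun s => r s a)
    (hP : ∀ k, WeaklyContinuous (Pgen k)) (hWsub : W ⊆ stdSimplex ℝ (Fin K)) (hWc : IsClosed W)
    (hWne : W.Nonempty) (v w : S →ᵇ ℝ) (s : S) :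
    robustBellman γ r (mixtureAmbiguitySet W Pgen) v s ≤
      robustBellman γ r (mixtureAmbiguitySet W Pgen) w s + γ * ‖v - w‖ := by
  obtain ⟨P₁, hP₁, π, h₁⟩ := exists_optimalPair (γ := γ) hrc hP hWsub hWc hWne v
  obtain ⟨P₂, hP₂, h₂⟩ := exists_evalOp_le_robustBellman (γ := γ) hrc hP hWsub hWc hWne w π
  have : ∀ a, IsProbabilityMeasure (P₂.1 (s, a)) := fun a => inferInstance
  calc robustBellman γ r (mixtureAmbiguitySet W Pgen) v s = evalOp γ r P₁ π v s := (h₁ s).2.1.symm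
    _ ≤ evalOp γ r P₂ π v s := (h₁ s).2.2 P₂ hP₂
    _ ≤ evalOp γ r P₂ π w s + γ * ‖v - w‖ := oneStep_le_add hγ0 v w s _ _
    _ ≤ _ := by linarith [h₂ s]

theorem abs_robustBellman_le (hγ0 : 0 < γ) (hrc : ∀ a, Continuous fun s => r s a)
    (hr : ∀ s a, |r s a| ≤ 1)
    (hP : ∀ k, WeaklyContinuous (Pgen k)) (hWsub : W ⊆ stdSimplex ℝ (Fin K)) (hWc : IsClosed W)
    (hWne : W.Nonempty) (v : S →ᵇ ℝ) (s : S) :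
    |robustBellman γ r (mixtureAmbiguitySet W Pgen) v s| ≤ 1 + γ * ‖v‖ := by
  obtain ⟨P', hP', π, h⟩ := exists_optimalPair (γ := γ) hrc hP hWsub hWc hWne v
  have : ∀ a, IsProbabilityMeasure (P'.1 (s, a)) := fun a => inferInstance
  rw [← (h s).2.1]
  exact abs_oneStep_le hγ0 hr v s _ _

end OptimalPairs

end RobustMDP

/-! ### The fixed point and the optimal robust value -/

theorem mainTheorem6 {d K : ℕ} (S : Set (EuclideanSpace ℝ (Fin d))) (hS : IsClosed S)
    {A : Type} [Fintype A] [Nonempty A] [MeasurableSpace A] [DiscreteMeasurableSpace A]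
    (γ : ℝ) (hγ0 : 0 < γ) (hγ1 : γ < 1)
    (r : S → A → ℝ) (hrc : ∀ a, Continuous (fun s => r s a))
    (hr : ∀ s a, r s a ∈ Set.Icc (0 : ℝ) 1)
    (Pgen : Fin K → RobustMDP.TransitionKernel S A)
    (hP : ∀ k, RobustMDP.WeaklyContinuous (Pgen k))
    (W : Set (Fin K → ℝ)) (hWsub : W ⊆ stdSimplex ℝ (Fin K)) (hWc : IsClosed W)
    (hWne : W.Nonempty)
    (Amb : Set (RobustMDP.TransitionKernel S A))
    (hAmb : Amb = RobustMDP.mixtureAmbiguitySet W Pgen) :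
    -- (i) worst-case kernels and optimal policies for one Bellman step
    (∀ v : S →ᵇ ℝ,
      (∃ Q : Kernel ((S × stdSimplex ℝ A) × A) S, IsMarkovKernel Q ∧
        (∀ (s : S) (p : stdSimplex ℝ A),
          (fun a => Q ((s, p), a)) ∈ RobustMDP.mixtureMarginal W Pgen s ∧
          ∀ R ∈ RobustMDP.mixtureMarginal W Pgen s,
            RobustMDP.oneStep γ r v s p (fun a => Q ((s, p), a)) ≤
              RobustMDP.oneStep γ r v s p R) ∧
        ∀ π : RobustMDP.Policy S A, ∃ P' ∈ Amb,
          (∀ s a, P'.1 (s, a) = Q ((s, π.1 s), a)) ∧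
          ∀ s, RobustMDP.evalOp γ r P' π v s = RobustMDP.robustEvalOp γ r Amb π v s) ∧
      (∃ π' : RobustMDP.Policy S A, ∀ s,
        RobustMDP.robustEvalOp γ r Amb π' v s = RobustMDP.robustBellman γ r Amb v s) ∧
      (∃ P' ∈ Amb, ∃ π' : RobustMDP.Policy S A, ∀ s,
        RobustMDP.evalOp γ r P' π' v s = RobustMDP.robustEvalOp γ r Amb π' v s ∧
        RobustMDP.evalOp γ r P' π' v s = RobustMDP.robustBellman γ r Amb v s)) ∧
    -- (ii) the robust Bellman operator on bounded continuous functions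
    (∃ T : (S →ᵇ ℝ) → (S →ᵇ ℝ),
      (∀ v s, T v s = RobustMDP.robustBellman γ r Amb v s) ∧
      (∀ v w, ‖T v - T w‖ ≤ γ * ‖v - w‖) ∧
      (∃! vstar : S →ᵇ ℝ, T vstar = vstar) ∧
      ∀ vstar : S →ᵇ ℝ, T vstar = vstar →
        (∀ v₀ : S →ᵇ ℝ, Tendsto (fun n : ℕ => T^[n] v₀) atTop (𝓝 vstar)) ∧
        -- (iii) the fixed point is the optimal robust value
        (∀ Pstar ∈ Amb, ∀ πstar : RobustMDP.Policy S A,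
          (∀ s, RobustMDP.evalOp γ r Pstar πstar vstar s =
            RobustMDP.robustBellman γ r Amb vstar s) →
          ∀ s, vstar s = RobustMDP.value γ r Pstar πstar s ∧
            vstar s = ⨆ π : RobustMDP.Policy S A, RobustMDP.robustValue γ r Amb π s) ∧
        (∃ Pstar ∈ Amb, ∃ πstar : RobustMDP.Policy S A, ∀ s,
          RobustMDP.evalOp γ r Pstar πstar vstar s =
            RobustMDP.robustBellman γ r Amb vstar s ∧
          vstar s = RobustMDP.value γ r Pstar πstar s ∧
          (∀ P ∈ Amb, RobustMDP.value γ r Pstar πstar s ≤ RobustMDP.value γ r P πstar s) ∧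
          RobustMDP.robustValue γ r Amb πstar s = vstar s ∧
          (∀ π : RobustMDP.Policy S A, RobustMDP.robustValue γ r Amb π s ≤ vstar s) ∧
          vstar s = ⨆ π : RobustMDP.Policy S A, RobustMDP.robustValue γ r Amb π s)) := by
  subst hAmb
  have hr' : ∀ s a, |r s a| ≤ 1 := fun s a => by
    rw [abs_of_nonneg (hr s a).1]
    exact (hr s a).2
  have hrm : ∀ a, Measurable fun s => r s a := fun a => (hrc a).measurable
  refine ⟨fun v => ⟨?_, ?_, ?_⟩, ?_⟩
  · obtain ⟨Q, hQm, hQ⟩ := RobustMDP.exists_worstCaseKernel (γ := γ) hrc hP hWsub hWc hWne v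
    refine ⟨Q, hQm, hQ, fun π => ?_⟩
    obtain ⟨P', hP', hP'Q, hev⟩ :=
      RobustMDP.exists_mem_mixtureAmbiguitySet_of_worstCaseKernel hQ π
    exact ⟨P', hP', hP'Q, fun s => (hev s).1⟩
  · obtain ⟨π', hπ'⟩ := RobustMDP.exists_optimalPolicy (γ := γ) hrc hP hWsub hWc hWne v
    exact ⟨π', fun s => (hπ' s).1⟩
  · obtain ⟨P', hP', π', h⟩ := RobustMDP.exists_optimalPair (γ := γ) hrc hP hWsub hWc hWne v
    exact ⟨P', hP', π', fun s => ⟨(h s).1, (h s).2.1⟩⟩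
  · let T : (S →ᵇ ℝ) → (S →ᵇ ℝ) := fun v =>
      BoundedContinuousFunction.ofNormedAddCommGroup
        (RobustMDP.robustBellman γ r (RobustMDP.mixtureAmbiguitySet W Pgen) v)
        (RobustMDP.continuous_robustBellman hrc hP hWsub hWc hWne v) (1 + γ * ‖v‖)
        (RobustMDP.abs_robustBellman_le hγ0 hrc hr' hP hWsub hWc hWne v)
    have hT : ∀ v s, T v s =
        RobustMDP.robustBellman γ r (RobustMDP.mixtureAmbiguitySet W Pgen) v s := fun v s => rfl
    have hcontr : ∀ v w, ‖T v - T w‖ ≤ γ * ‖v - w‖ := by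
      intro v w
      rw [BoundedContinuousFunction.norm_le (mul_nonneg hγ0.le (norm_nonneg _))]
      intro s
      rw [BoundedContinuousFunction.sub_apply, hT, hT, Real.norm_eq_abs, abs_sub_le_iff]
      have h1 := RobustMDP.robustBellman_le_add hγ0 hrc hP hWsub hWc hWne v w s
      have h2 := RobustMDP.robustBellman_le_add hγ0 hrc hP hWsub hWc hWne w v s
      rw [norm_sub_rev w v] at h2
      constructor <;> linarith
    have hCW : ContractingWith ⟨γ, hγ0.le⟩ T := by
      refine ⟨by exact_mod_cast hγ1, LipschitzWith.of_dist_le_mul fun v w => ?_⟩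
      rw [dist_eq_norm, dist_eq_norm]
      exact hcontr v w
    refine ⟨T, hT, hcontr, ⟨hCW.fixedPoint, hCW.fixedPoint_isFixedPt,
      fun v hv => hCW.fixedPoint_unique hv⟩, fun vstar hstar => ?_⟩
    have hfix : ∀ s, RobustMDP.robustBellman γ r (RobustMDP.mixtureAmbiguitySet W Pgen) vstar s =
        vstar s := fun s => by rw [← hT, hstar]
    have hvm : Measurable vstar := vstar.continuous.measurable
    have hvalue : ∀ P : RobustMDP.TransitionKernel S A, ∀ π : RobustMDP.Policy S A,
        (∀ s, RobustMDP.evalOp γ r P π vstar s = vstar s) →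
        ∀ s, vstar s = RobustMDP.value γ r P π s := fun P π h s =>
      le_antisymm
        (RobustMDP.le_value_of_le_evalOp hγ0 hγ1 hrm hr' hvm vstar.norm_coe_le_norm
          (fun s => (h s).ge) s)
        (RobustMDP.value_le_of_evalOp_le hγ0 hγ1 hrm hr' hvm vstar.norm_coe_le_norm
          (fun s => (h s).le) s)
    have hupper : ∀ (π : RobustMDP.Policy S A) s,
        RobustMDP.robustValue γ r (RobustMDP.mixtureAmbiguitySet W Pgen) π s ≤ vstar s := by
      intro π s
      obtain ⟨P', hP', h⟩ :=
        RobustMDP.exists_evalOp_le_robustBellman (γ := γ) hrc hP hWsub hWc hWne vstar π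
      exact RobustMDP.robustValue_le_of_evalOp_le hγ0 hγ1 hrc hr vstar hP'
        (fun s => (h s).trans_eq (hfix s)) s
    -- The equation `T_π^P v* = T v*` alone fixes the value of a pair, but does not say that `P` is
    -- worst for `π`. This pair also minimizes over kernels, which makes it attain both the infimum
    -- and the supremum.
    obtain ⟨P₀, hP₀, π₀, h₀⟩ :=
      RobustMDP.exists_optimalPair (γ := γ) hrc hP hWsub hWc hWne vstar
    have hv₀ := hvalue P₀ π₀ fun s => (h₀ s).2.1.trans (hfix s)
    have hworst : ∀ P ∈ RobustMDP.mixtureAmbiguitySet W Pgen, ∀ s,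
        vstar s ≤ RobustMDP.value γ r P π₀ s := fun P hPA s =>
      RobustMDP.le_value_of_le_evalOp hγ0 hγ1 hrm hr' hvm vstar.norm_coe_le_norm
        -- For every admissible `P`, `v* = T v* = T_{π₀}^{P₀} v* ≤ T_{π₀}^P v*`, so the residuals
        -- are nonnegative.
        (fun s => by rw [← hfix s, ← (h₀ s).2.1]; exact (h₀ s).2.2 P hPA) s
    have hrob : ∀ s,
        RobustMDP.robustValue γ r (RobustMDP.mixtureAmbiguitySet W Pgen) π₀ s = vstar s := by
      intro s
      have : Nonempty (RobustMDP.mixtureAmbiguitySet W Pgen) := ⟨⟨P₀, hP₀⟩⟩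
      exact le_antisymm (hupper π₀ s) (le_ciInf fun P => hworst P.1 P.2 s)
    have hsup : ∀ s, vstar s = ⨆ π : RobustMDP.Policy S A,
        RobustMDP.robustValue γ r (RobustMDP.mixtureAmbiguitySet W Pgen) π s := by
      intro s
      have : Nonempty (RobustMDP.Policy S A) := ⟨π₀⟩
      refine le_antisymm ?_ (ciSup_le fun π => hupper π s)
      rw [← hrob s]
      refine le_ciSup (f := fun π : RobustMDP.Policy S A =>
        RobustMDP.robustValue γ r (RobustMDP.mixtureAmbiguitySet W Pgen) π s) ⟨vstar s, ?_⟩ π₀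
      rintro _ ⟨π, rfl⟩
      exact hupper π s
    refine ⟨fun v₀ => ?_, fun P _ π h s => ?_, P₀, hP₀, π₀, fun s => ?_⟩
    · rw [hCW.fixedPoint_unique hstar]
      exact hCW.tendsto_iterate_fixedPoint v₀
    · exact ⟨hvalue P π (fun s => (h s).trans (hfix s)) s, hsup s⟩
    · refine ⟨(h₀ s).2.1, hv₀ s, fun P hPA => ?_, hrob s, fun π => hupper π s, hsup s⟩
      rw [← hv₀ s]
      exact hworst P hPA s
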